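/- Let $k$ be a field, let $\Lambda$ be a finite-dimensional $k$-algebra, and let $m\ge 1$ be an integer. Write $\operatorname{mod}\Lambda$ for the category of finitely generated left $\Lambda$-modules, and let \[ m\text{-}\operatorname{mod}\Lambda=\{X\in D^b(\operatorname{mod}\Lambda)\mid H^i(X)=0\text{ for all } i\notin[-(m-1),0]\}, \] a full subcategory of the bounded derived category $D^b(\operatorname{mod}\Lambda)$. Say that $m\text{-}\operatorname{mod}\Lambda$ is of finite type if it has only finitely many indecomposable objects up to isomorphism. Let $e\in\Lambda$ be an idempotent, and regard $e\Lambda e$ as a finite-dimensional $k$-algebra with unit $e$. If $m\text{-}\operatorname{mod}\Lambda$ is of finite type, then $m\text{-}\operatorname{mod}e\Lambda e$ is of finite type. -/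

import Mathlib

open CategoryTheory CategoryTheory.Limits

universe w₁ w₂ u v

/-! ### The corner algebra `eΛe`

As a ring, `eΛe` is Mathlib's `IsIdempotentElem.Corner`, with unit `e`.
Here it gets its structure of a finite-dimensional algebra. -/

section Corner

variable {k : Type u} {Λ : Type v} [Field k] [Ring Λ] [Algebra k Λ] {e : Λ}

/-- Scalars act on `eΛe` as they do on `Λ`. -/
noncomputable instance IsIdempotentElem.Corner.instModule (he : IsIdempotentElem e) :
    Module k he.Corner where
  smul c x := ⟨c • x.1, (Subsemigroup.mem_corner_iff he).2
    ⟨by rw [mul_smul_comm, ((Subsemigroup.mem_corner_iff he).1 x.2).1],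
     by rw [smul_mul_assoc, ((Subsemigroup.mem_corner_iff he).1 x.2).2]⟩⟩
  one_smul x := Subtype.ext (one_smul k x.1)
  mul_smul a b x := Subtype.ext (mul_smul a b x.1)
  smul_zero a := Subtype.ext (smul_zero a)
  smul_add a x y := Subtype.ext (smul_add a x.1 y.1)
  add_smul a b x := Subtype.ext (add_smul a b x.1)
  zero_smul x := Subtype.ext (zero_smul k x.1)

noncomputable instance IsIdempotentElem.Corner.instAlgebra (he : IsIdempotentElem e) :
    Algebra k he.Corner :=
  Algebra.ofModule
    (fun c x y => Subtype.ext (smul_mul_assoc c x.1 y.1))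
    (fun c x y => Subtype.ext (mul_smul_comm c x.1 y.1))

instance IsIdempotentElem.Corner.instFiniteDimensional [FiniteDimensional k Λ]
    (he : IsIdempotentElem e) : FiniteDimensional k he.Corner :=
  FiniteDimensional.of_injective
    ({ toFun := fun x => x.1
       map_add' := fun _ _ => rfl
       map_smul' := fun _ _ => rfl } : he.Corner →ₗ[k] Λ)
    Subtype.val_injective

end Corner

/-! ### The category `mod Λ` -/

section ModuleCategory

/-- `mod Λ`: the category of finitely generated left modules over the `k`-algebra `Λ`.
The field `k` is recorded only in order that `mod Λ` is seen to be abelian. -/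
@[nolint unusedArguments]
def FinMod (k : Type u) (Λ : Type v) [Field k] [Ring Λ] [Algebra k Λ] : Type (v + 1) :=
  FGModuleCat.{v} Λ

variable (k : Type u) (Λ : Type v) [Field k] [Ring Λ] [Algebra k Λ]

noncomputable instance FinMod.instCategory : Category.{v} (FinMod k Λ) :=
  inferInstanceAs (Category.{v} (FGModuleCat.{v} Λ))

noncomputable instance FinMod.instAbelian [FiniteDimensional k Λ] : Abelian (FinMod k Λ) :=
  haveI : IsNoetherianRing Λ := isNoetherian_of_tower k inferInstance
  inferInstanceAs (Abelian (FGModuleCat.{v} Λ))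

end ModuleCategory

/-! ### The `m`-extended module category -/

section ExtendedModules

variable (k : Type u) (Λ : Type v) [Field k] [Ring Λ] [Algebra k Λ] [FiniteDimensional k Λ]
  [HasDerivedCategory.{w₁} (FinMod k Λ)] (m : ℕ)

/-- The objects `X` of `D^b(mod Λ)` such that `H^i(X) = 0` for all `i ∉ [-(m-1), 0]`. -/
def isExtMod : ObjectProperty (DerivedCategory.Bounded (FinMod k Λ)) :=
  fun X => ∀ i : ℤ, i ∉ Set.Icc (-((m : ℤ) - 1)) 0 →
    IsZero ((DerivedCategory.homologyFunctor (FinMod k Λ) i).obj X.obj)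

/-- `m`-mod `Λ`, as a full subcategory of `D^b(mod Λ)`. -/
abbrev ExtMod : Type (v + 1) := (isExtMod k Λ m).FullSubcategory

instance isExtMod.instIsClosedUnderBinaryProducts :
    (isExtMod k Λ m).IsClosedUnderBinaryProducts where
  limitsOfShape_le := by
    rintro X ⟨p⟩ i hi
    let F := DerivedCategory.Bounded.ι ⋙ DerivedCategory.homologyFunctor (FinMod k Λ) i
    have : F.Additive := inferInstance
    have : PreservesLimitsOfShape (Discrete WalkingPair) F := inferInstance
    have hl := isLimitOfPreserves F p.isLimit
    rw [IsZero.iff_id_eq_zero]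
    exact hl.hom_ext fun j => (p.prop_diag_obj j i hi).eq_of_tgt _ _

instance ExtMod.instHasBinaryBiproducts : HasBinaryBiproducts (ExtMod k Λ m) :=
  HasBinaryBiproducts.of_hasBinaryProducts

end ExtendedModules

/-- A category is of finite type if it has, up to isomorphism, only finitely many indecomposable
objects. -/
def IsOfFiniteType (C : Type*) [Category* C] [HasZeroMorphisms C] [HasBinaryBiproducts C] : Prop :=
  {c : Quotient (isIsomorphicSetoid C) | ∃ X : C, Indecomposable X ∧ Quotient.mk _ X = c}.Finite

/-! The functor `M ↦ eM` is exact, so it acts on complexes degreewise, commutes with cohomology and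
induces an additive functor `ExtMod.part` from `m`-mod `Λ` to `m`-mod `eΛe`.

This functor is essentially surjective. An object of the target is represented by a complex `K`
living in degrees `[-(m-1), 0]`. Applying `N ↦ Hom_{eΛe}(eΛ, N)` to each term of `K`, without
deriving, gives a complex of `Λ`-modules in the same degrees, and `e Hom_{eΛe}(eΛ, N) ≅ N` shows
that its image is `K` again (`exists_mapDerivedCategory_iso`).

An indecomposable `X` in the target therefore has a preimage, and one of least total cohomology
length is indecomposable (`exists_indecomposable_lift`). So the finitely many indecomposable classes
of `m`-mod `Λ` cover those of `m`-mod `eΛe`. -/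

/-! ### The modules `eM` and `Hom_{eΛe}(eΛ, N)` -/

section CornerModules

namespace IsIdempotentElem

variable {k : Type u} {Λ : Type v} [Field k] [Ring Λ] [Algebra k Λ] {e : Λ}

lemma Corner.mul_val (he : IsIdempotentElem e) (c : he.Corner) : e * c.1 = c.1 :=
  ((Subsemigroup.mem_corner_iff he).1 c.2).1

lemma Corner.val_mul (he : IsIdempotentElem e) (c : he.Corner) : c.1 * e = c.1 :=
  ((Subsemigroup.mem_corner_iff he).1 c.2).2

lemma Corner.algebraMap_val (he : IsIdempotentElem e) (c : k) :
    (algebraMap k he.Corner c).1 = c • e := by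
  rw [Algebra.algebraMap_eq_smul_one]
  rfl

/-- The part `eM` of a `Λ`-module `M`, as an additive subgroup. -/
def part (_ : IsIdempotentElem e) (M : Type*) [AddCommGroup M] [Module Λ M] : AddSubgroup M where
  carrier := {m | e • m = m}
  zero_mem' := smul_zero e
  add_mem' {a b} ha hb := by
    change e • (a + b) = a + b
    rw [smul_add, ha, hb]
  neg_mem' {a} ha := by
    change e • (-a) = -a
    rw [smul_neg, ha]

variable (he : IsIdempotentElem e)

section part

variable {M N : Type*} [AddCommGroup M] [Module Λ M] [AddCommGroup N] [Module Λ N]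

lemma smul_part (m : he.part M) : e • m.1 = m.1 := m.2

/-- `eM` is a module over `eΛe`. -/
instance instModulePart : Module he.Corner (he.part M) where
  smul c m := ⟨c.1 • m.1, by
    change e • c.1 • m.1 = c.1 • m.1
    rw [smul_smul, Corner.mul_val]⟩
  one_smul m := Subtype.ext m.2
  mul_smul a b m := Subtype.ext (mul_smul a.1 b.1 m.1)
  smul_zero a := Subtype.ext (smul_zero a.1)
  smul_add a x y := Subtype.ext (smul_add a.1 x.1 y.1)
  add_smul a b x := Subtype.ext (add_smul a.1 b.1 x.1)
  zero_smul x := Subtype.ext (zero_smul Λ x.1)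

/-- The map `eM → eN` induced by a linear map `M → N`. -/
def partMap (f : M →ₗ[Λ] N) : he.part M →ₗ[he.Corner] he.part N where
  toFun m := ⟨f m.1, by
    change e • f m.1 = f m.1
    rw [← map_smul, he.smul_part]⟩
  map_add' x y := Subtype.ext (map_add f x.1 y.1)
  map_smul' c x := Subtype.ext (map_smul f c.1 x.1)

lemma finite_part (k : Type u) [Field k] [Algebra k Λ] [FiniteDimensional k Λ]
    [Module.Finite Λ M] : Module.Finite he.Corner (he.part M) := by
  let _ : Module k M := Module.compHom M (algebraMap k Λ)
  have : IsScalarTower k Λ M := IsScalarTower.of_algebraMap_smul fun _ _ => rfl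
  have : Module.Finite k M := Module.Finite.trans Λ M
  let _ : Module k (he.part M) := Module.compHom _ (algebraMap k he.Corner)
  have : IsScalarTower k he.Corner (he.part M) :=
    IsScalarTower.of_algebraMap_smul fun _ _ => rfl
  let i : he.part M →ₗ[k] M :=
    { toFun := Subtype.val
      map_add' := fun _ _ => rfl
      map_smul' := fun c m => by
        change (algebraMap k he.Corner c).1 • m.1 = c • m.1
        rw [Corner.algebraMap_val, smul_assoc, he.smul_part] }
  have : Module.Finite k (he.part M) := Module.Finite.of_injective i Subtype.val_injective
  exact Module.Finite.of_restrictScalars_finite k he.Corner (he.part M)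

end part

section coind

/-- The additive group underlying the `Λ`-module `Hom_{eΛe}(eΛ, N)`: a linear map on `eΛ` is
identified with its extension by `0` to `Λ = eΛ ⊕ (1 - e)Λ`. -/
def coind (N : Type*) [AddCommGroup N] [Module he.Corner N] : AddSubgroup (Λ →+ N) where
  carrier := {f | ∀ (c : he.Corner) (x : Λ), f (c.1 * x) = c • f x}
  zero_mem' c x := (smul_zero c).symm
  add_mem' {f g} hf hg c x := by
    rw [AddMonoidHom.add_apply, hf, hg, AddMonoidHom.add_apply, smul_add]
  neg_mem' {f} hf c x := by
    rw [AddMonoidHom.neg_apply, hf, AddMonoidHom.neg_apply, smul_neg]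

variable {N N' : Type*} [AddCommGroup N] [Module he.Corner N]
  [AddCommGroup N'] [Module he.Corner N']

/-- `Λ` acts on `Hom_{eΛe}(eΛ, N)` through its right action on `eΛ`. -/
instance instModuleCoind : Module Λ (he.coind N) where
  smul a f := ⟨f.1.comp (AddMonoidHom.mulRight a), fun c x => by
    change f.1 (c.1 * x * a) = c • f.1 (x * a)
    rw [mul_assoc, f.2]⟩
  one_smul f := Subtype.ext (AddMonoidHom.ext fun x => congrArg f.1 (mul_one x))
  mul_smul a b f := Subtype.ext (AddMonoidHom.ext fun x => congrArg f.1 (mul_assoc x a b).symm)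
  smul_zero a := rfl
  smul_add a f g := rfl
  add_smul a b f := Subtype.ext (AddMonoidHom.ext fun x =>
    (congrArg f.1 (mul_add x a b)).trans (map_add f.1 _ _))
  zero_smul f := Subtype.ext (AddMonoidHom.ext fun x =>
    (congrArg f.1 (mul_zero x)).trans (map_zero f.1))

/-- The map `Hom_{eΛe}(eΛ, N) → Hom_{eΛe}(eΛ, N')` induced by a linear map `N → N'`. -/
def coindMap (g : N →ₗ[he.Corner] N') : he.coind N →ₗ[Λ] he.coind N' where
  toFun f := ⟨g.toAddMonoidHom.comp f.1, fun c x => by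
    change g (f.1 (c.1 * x)) = c • g (f.1 x)
    rw [f.2, map_smul]⟩
  map_add' x y := Subtype.ext (AddMonoidHom.ext fun _ => map_add g _ _)
  map_smul' c x := rfl

/-- The module embeds `k`-linearly into the finite-dimensional space `Λ →ₗ[k] N`. -/
lemma finite_coind (k : Type u) [Field k] [Algebra k Λ] [FiniteDimensional k Λ]
    [Module.Finite he.Corner N] : Module.Finite Λ (he.coind N) := by
  let _ : Module k N := Module.compHom N (algebraMap k he.Corner)
  have : IsScalarTower k he.Corner N := IsScalarTower.of_algebraMap_smul fun _ _ => rfl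
  have : Module.Finite k N := Module.Finite.trans he.Corner N
  let _ : Module k (he.coind N) := Module.compHom _ (algebraMap k Λ)
  have : IsScalarTower k Λ (he.coind N) := IsScalarTower.of_algebraMap_smul fun _ _ => rfl
  -- The unit of `eΛe` is `e`, so semilinearity at `1` says that `f` vanishes on `(1 - e)Λ`.
  have key (f : he.coind N) (x : Λ) : f.1 (e * x) = f.1 x := (f.2 1 x).trans (one_smul _ _)
  have hk (f : he.coind N) (c : k) (x : Λ) : f.1 (c • x) = c • f.1 x := by
    rw [← key f (c • x), mul_smul_comm, ← smul_mul_assoc, ← Corner.algebraMap_val he, f.2]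
    rfl
  let i : he.coind N →ₗ[k] (Λ →ₗ[k] N) :=
    { toFun := fun f =>
        { toFun := f.1
          map_add' := map_add f.1
          map_smul' := fun c x => hk f c x }
      map_add' := fun _ _ => rfl
      map_smul' := fun c f => LinearMap.ext fun x => by
        change f.1 (x * algebraMap k Λ c) = c • f.1 x
        rw [← Algebra.commutes, ← Algebra.smul_def, hk] }
  have : Module.Finite k (he.coind N) := Module.Finite.of_injective i fun f g h =>
    Subtype.ext (AddMonoidHom.ext fun x => congrArg (fun l : Λ →ₗ[k] N => l x) h)
  exact Module.Finite.of_restrictScalars_finite k Λ (he.coind N)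

/-- The element `exe` of the corner `eΛe`. -/
def compress (x : Λ) : he.Corner :=
  ⟨e * x * e, (Subsemigroup.mem_corner_iff he).2
    ⟨by rw [← mul_assoc, ← mul_assoc, he.eq], by rw [mul_assoc, he.eq]⟩⟩

/-- Evaluation at `e` identifies `e Hom_{eΛe}(eΛ, N)` with `N`. -/
def partCoindEquiv (N : Type*) [AddCommGroup N] [Module he.Corner N] :
    he.part (he.coind N) ≃ₗ[he.Corner] N where
  toFun f := f.1.1 e
  map_add' _ _ := rfl
  map_smul' c f := by
    change f.1.1 (e * c.1) = c • f.1.1 e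
    rw [← f.1.2, Corner.mul_val, Corner.val_mul]
  -- An `f` fixed by `e` satisfies `f x = f (x * e)`, hence `f x = f (e * x * e) = (exe) • f e`;
  -- this forces the formula for the inverse.
  invFun n := ⟨⟨{
      toFun := fun x => he.compress x • n
      map_zero' := by
        convert zero_smul he.Corner n
        exact Subtype.ext (by change e * 0 * e = 0; rw [mul_zero, zero_mul])
      map_add' := fun x y => by
        rw [← add_smul]
        congr 1
        refine Subtype.ext ?_
        change e * (x + y) * e = e * x * e + e * y * e
        rw [mul_add, add_mul] },
      fun c x => by
        change he.compress (c.1 * x) • n = c • he.compress x • n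
        rw [smul_smul]
        congr 1
        refine Subtype.ext ?_
        change e * (c.1 * x) * e = c.1 * (e * x * e)
        rw [← mul_assoc, Corner.mul_val, ← mul_assoc, ← mul_assoc, Corner.val_mul]⟩, by
    refine Subtype.ext (AddMonoidHom.ext fun x => ?_)
    change he.compress (x * e) • n = he.compress x • n
    congr 1
    refine Subtype.ext ?_
    change e * (x * e) * e = e * x * e
    rw [← mul_assoc, mul_assoc _ e e, he.eq]⟩
  left_inv f := by
    refine Subtype.ext (Subtype.ext (AddMonoidHom.ext fun x => ?_))
    change he.compress x • f.1.1 e = f.1.1 x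
    rw [← f.1.2]
    change f.1.1 (e * x * e * e) = f.1.1 x
    have h1 : f.1.1 (e * x) = f.1.1 x := (f.1.2 1 x).trans (one_smul _ _)
    have h2 : f.1.1 (e * x * e) = f.1.1 (e * x) := DFunLike.congr_fun (congrArg Subtype.val f.2) _
    rw [mul_assoc _ e e, he.eq, h2, h1]
  right_inv n := by
    change he.compress e • n = n
    convert one_smul he.Corner n
    refine Subtype.ext ?_
    change e * e * e = e
    rw [he.eq, he.eq]

end coind

end IsIdempotentElem

end CornerModules

/-! ### The exact functor `M ↦ eM` and its section -/

section CornerFunctors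

namespace FinMod

variable (k : Type u) {Λ : Type v} [Field k] [Ring Λ] [Algebra k Λ] [FiniteDimensional k Λ]
  {e : Λ} (he : IsIdempotentElem e)

/-- The functor `M ↦ eM` from `mod Λ` to `mod eΛe`. -/
def part : FinMod k Λ ⥤ FinMod k he.Corner where
  obj (M : FGModuleCat.{v} Λ) :=
    have := he.finite_part (M := M) k
    FGModuleCat.of he.Corner (he.part M)
  map {M N : FGModuleCat.{v} Λ} f :=
    have := he.finite_part (M := M) k
    have := he.finite_part (M := N) k
    FGModuleCat.ofHom (he.partMap (InducedCategory.Hom.hom f).hom)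
  map_id _ := rfl
  map_comp _ _ := rfl

instance : (part k he).Additive where
  map_add := rfl

/-- The functor `N ↦ Hom_{eΛe}(eΛ, N)` from `mod eΛe` to `mod Λ`. -/
def coind : FinMod k he.Corner ⥤ FinMod k Λ where
  obj (N : FGModuleCat.{v} he.Corner) :=
    have := he.finite_coind (N := N) k
    FGModuleCat.of Λ (he.coind N)
  map {N N' : FGModuleCat.{v} he.Corner} f :=
    have := he.finite_coind (N := N) k
    have := he.finite_coind (N := N') k
    FGModuleCat.ofHom (he.coindMap (InducedCategory.Hom.hom f).hom)
  map_id _ := rfl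
  map_comp _ _ := rfl

instance : (coind k he).Additive where
  map_add := rfl

/-- `e Hom_{eΛe}(eΛ, N)` is naturally isomorphic to `N`. -/
noncomputable def coindPartIso : coind k he ⋙ part k he ≅ 𝟭 (FinMod k he.Corner) :=
  NatIso.ofComponents (fun (N : FGModuleCat.{v} he.Corner) =>
    have := he.finite_coind (N := N) k
    have := he.finite_part (M := he.coind N) k
    (he.partCoindEquiv N).toFGModuleCatIso) (fun _ => rfl)

variable (Λ) in
/-- The inclusion of `mod Λ` into the category of all `Λ`-modules. -/
def toModuleCat : FinMod k Λ ⥤ ModuleCat.{v} Λ := (ModuleCat.isFG.{v} Λ).ι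

instance : (toModuleCat k Λ).Additive where
  map_add := rfl

instance : (toModuleCat k Λ).Faithful :=
  inferInstanceAs (ModuleCat.isFG.{v} Λ).ι.Faithful

instance : PreservesFiniteLimits (toModuleCat k Λ) :=
  have : IsNoetherianRing Λ := isNoetherian_of_tower k inferInstance
  inferInstanceAs (PreservesFiniteLimits (forget₂ (FGModuleCat.{v} Λ) (ModuleCat.{v} Λ)))

instance : PreservesFiniteColimits (toModuleCat k Λ) :=
  inferInstanceAs (PreservesFiniteColimits (forget₂ (FGModuleCat.{v} Λ) (ModuleCat.{v} Λ)))

instance (M : FinMod k Λ) : Module.Finite Λ ((toModuleCat k Λ).obj M) :=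
  ObjectProperty.FullSubcategory.property (P := ModuleCat.isFG.{v} Λ) M

lemma isZero_iff_subsingleton (M : FinMod k Λ) :
    IsZero M ↔ Subsingleton ((toModuleCat k Λ).obj M) := by
  rw [← ModuleCat.isZero_iff_subsingleton, IsZero.iff_id_eq_zero, IsZero.iff_id_eq_zero,
    ← (toModuleCat k Λ).map_id]
  exact ((toModuleCat k Λ).map_eq_zero_iff).symm

lemma exact_iff (S : ShortComplex (FinMod k Λ)) :
    S.Exact ↔ ∀ x : (toModuleCat k Λ).obj S.X₂, (toModuleCat k Λ).map S.g x = 0 →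
      ∃ y : (toModuleCat k Λ).obj S.X₁, (toModuleCat k Λ).map S.f y = x := by
  rw [← S.exact_map_iff_of_faithful (toModuleCat k Λ), ShortComplex.moduleCat_exact_iff]
  rfl

/-- If `y` is a preimage of `x` and `e • x = x`, then `e • y` is a preimage of `x` lying in the
`e`-part. -/
lemma exact_map_part (S : ShortComplex (FinMod k Λ)) (hS : S.Exact) :
    (S.map (part k he)).Exact := by
  rw [exact_iff] at hS ⊢
  intro x hx
  obtain ⟨y, hy⟩ := hS x.1 (congrArg Subtype.val hx)
  refine ⟨⟨e • y, ?_⟩, Subtype.ext ?_⟩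
  · change e • e • y = e • y
    rw [smul_smul, he.eq]
  · change (toModuleCat k Λ).map S.f (e • y) = x.1
    rw [map_smul, hy]
    exact x.2

lemma exact_part : PreservesFiniteLimits (part k he) ∧ PreservesFiniteColimits (part k he) :=
  ((part k he).exact_tfae.out 1 3).1 (exact_map_part k he)

instance : PreservesFiniteLimits (part k he) := (exact_part k he).1

instance : PreservesFiniteColimits (part k he) := (exact_part k he).2

end FinMod

end CornerFunctors

/-! ### Transfer of finite type along essentially surjective functors -/

section FiniteType

variable {C D : Type*} [Category* C] [Category* D] [Preadditive C] [Preadditive D]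
  [HasBinaryBiproducts C] [HasBinaryBiproducts D]

/-- If the objects of `C` have an additive length, then each indecomposable object in the image
of an additive functor is the image of an indecomposable object. -/
lemma exists_indecomposable_lift (F : C ⥤ D) [F.Additive] (ℓ : C → ℕ)
    (ℓ_iso : ∀ {Y Z : C}, (Y ≅ Z) → ℓ Y = ℓ Z) (ℓ_biprod : ∀ Y Z : C, ℓ (Y ⊞ Z) = ℓ Y + ℓ Z)
    (ℓ_zero : ∀ Y : C, ℓ Y = 0 → IsZero Y) {X : D} (hX : Indecomposable X)
    (hFX : ∃ Y : C, Nonempty (F.obj Y ≅ X)) :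
    ∃ Y : C, Indecomposable Y ∧ Nonempty (F.obj Y ≅ X) := by
  -- Among all lifts of `X`, take one of least length.
  obtain ⟨Y, ⟨i⟩, hY⟩ : ∃ Y : C, Nonempty (F.obj Y ≅ X) ∧
      ∀ Z : C, Nonempty (F.obj Z ≅ X) → ℓ Y ≤ ℓ Z := by
    obtain ⟨Y, hY⟩ := hFX
    obtain ⟨Z, hZ, hmin⟩ := (measure ℓ).wf.has_min {Z | Nonempty (F.obj Z ≅ X)} ⟨Y, hY⟩
    exact ⟨Z, hZ, fun W hW => not_lt.1 (hmin W hW)⟩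
  refine ⟨Y, ⟨fun h => hX.1 ((F.map_isZero h).of_iso i.symm), fun Z W j => ?_⟩, ⟨i⟩⟩
  have hℓ : ℓ Y = ℓ Z + ℓ W := (ℓ_iso j).trans (ℓ_biprod Z W)
  have : PreservesBinaryBiproducts F := preservesBinaryBiproducts_of_preservesBiproducts F
  let s : X ≅ F.obj Z ⊞ F.obj W := i.symm ≪≫ F.mapIso j ≪≫ F.mapBiprod Z W
  -- If one summand of `Y` is killed by `F`, the other still lifts `X`; minimality then gives the
  -- killed summand length `0`.
  obtain h | h := hX.2 _ _ s
  · refine Or.inl (ℓ_zero Z ?_)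
    have := hY W ⟨(isoZeroBiprod h) ≪≫ s.symm⟩
    lia
  · refine Or.inr (ℓ_zero W ?_)
    have := hY Z ⟨(isoBiprodZero h) ≪≫ s.symm⟩
    lia

lemma IsOfFiniteType.of_essSurj (F : C ⥤ D) [F.Additive] [F.EssSurj] (ℓ : C → ℕ)
    (ℓ_iso : ∀ {Y Z : C}, (Y ≅ Z) → ℓ Y = ℓ Z) (ℓ_biprod : ∀ Y Z : C, ℓ (Y ⊞ Z) = ℓ Y + ℓ Z)
    (ℓ_zero : ∀ Y : C, ℓ Y = 0 → IsZero Y) (hC : IsOfFiniteType C) : IsOfFiniteType D := by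
  let q : Quotient (isIsomorphicSetoid C) → Quotient (isIsomorphicSetoid D) :=
    Quotient.map F.obj fun _ _ ⟨i⟩ => ⟨F.mapIso i⟩
  refine (hC.image q).subset ?_
  rintro _ ⟨X, hX, rfl⟩
  obtain ⟨Y, hY, hi⟩ := exists_indecomposable_lift F ℓ ℓ_iso ℓ_biprod ℓ_zero hX (Functor.EssSurj.mem_essImage F X)
  exact ⟨Quotient.mk _ Y, ⟨Y, hY, rfl⟩, Quotient.sound hi⟩

end FiniteType

/-! ### Exact functors on derived categories -/

section DerivedFunctors

variable {A B : Type*} [Category* A] [Category* B] [Abelian A] [Abelian B]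
  [HasDerivedCategory.{w₁} A] [HasDerivedCategory.{w₂} B]

namespace DerivedCategory

lemma isZero_of_isZero_homology (X : DerivedCategory A)
    (h : ∀ i, IsZero ((homologyFunctor A i).obj X)) : IsZero X := by
  have : X.IsLE 0 := (isLE_iff X 0).2 fun i _ => h i
  have : X.IsGE 1 := (isGE_iff X 1).2 fun i _ => h i
  exact TStructure.t.isZero X 0 1 (by lia)

variable (F : A ⥤ B) [F.Additive] [PreservesFiniteLimits F] [PreservesFiniteColimits F]

/-- The homology of the image of an object under an exact functor. -/
lemma nonempty_homology_mapDerivedCategory_iso (X : DerivedCategory A) (i : ℤ) :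
    Nonempty ((homologyFunctor B i).obj (F.mapDerivedCategory.obj X) ≅
      F.obj ((homologyFunctor A i).obj X)) := by
  let K := Q.objPreimage X
  let α : Q.obj K ≅ X := Q.objObjPreimageIso X
  exact ⟨(homologyFunctor B i).mapIso
      (F.mapDerivedCategory.mapIso α.symm ≪≫ F.mapDerivedCategoryFactors.app K) ≪≫
    (homologyFunctorFactors B i).app _ ≪≫ (K.sc i).mapHomologyIso F ≪≫
    F.mapIso ((homologyFunctorFactors A i).symm.app K ≪≫ (homologyFunctor A i).mapIso α)⟩

lemma bounded_mapDerivedCategory (X : DerivedCategory A) (hX : TStructure.t.bounded X) :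
    TStructure.t.bounded (F.mapDerivedCategory.obj X) := by
  have h (i : ℤ) (hi : IsZero ((homologyFunctor A i).obj X)) :=
    (F.map_isZero hi).of_iso (nonempty_homology_mapDerivedCategory_iso F X i).some
  obtain ⟨⟨a, ha⟩, b, hb⟩ := hX
  refine ⟨⟨a, ?_⟩, b, ?_⟩
  · exact (isGE_iff _ a).2 fun i hi => h i ((isGE_iff X a).1 ha i hi)
  · exact (isLE_iff _ b).2 fun i hi => h i ((isLE_iff X b).1 hb i hi)

/-- If `F` is exact and `G` is a section of `F`, not necessarily exact, then an object of the
derived category with homology in `[a, b]` is the image of such an object. -/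
lemma exists_mapDerivedCategory_iso (G : B ⥤ A) [G.Additive] (η : G ⋙ F ≅ 𝟭 B)
    (X : DerivedCategory B) (a b : ℤ) [X.IsGE a] [X.IsLE b] :
    ∃ Y : DerivedCategory A, Y.IsGE a ∧ Y.IsLE b ∧ Nonempty (F.mapDerivedCategory.obj Y ≅ X) := by
  obtain ⟨K, _, _, ⟨i⟩⟩ := X.exists_iso_Q_obj_of_isGE_of_isLE a b
  -- As `G` need not be exact, `L` depends on the choice of `K`, but only its existence matters: it
  -- stays in degrees `[a, b]`, and `F` returns it to `K` as a complex.
  let L : CochainComplex A ℤ := (G.mapHomologicalComplex (ComplexShape.up ℤ)).obj K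
  have : L.IsStrictlyGE a := HomologicalComplex.map_isStrictlySupported K G _
  have : L.IsStrictlyLE b := HomologicalComplex.map_isStrictlySupported K G _
  refine ⟨Q.obj L, inferInstance, inferInstance,
    ⟨F.mapDerivedCategoryFactors.app L ≪≫ Q.mapIso ?_ ≪≫ i.symm⟩⟩
  exact (NatIso.mapHomologicalComplex η _).app K

end DerivedCategory

end DerivedFunctors

/-! ### Length of finitely generated modules -/

section Length

variable (k : Type u) {Λ : Type v} [Field k] [Ring Λ] [Algebra k Λ]

namespace FinMod

/-- The length of a finitely generated module. -/
noncomputable def length (M : FinMod k Λ) : ℕ :=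
  (Module.length Λ ((toModuleCat k Λ).obj M)).toNat

variable {k}

lemma length_eq_of_iso {M N : FinMod k Λ} (i : M ≅ N) : length k M = length k N :=
  congrArg ENat.toNat ((toModuleCat k Λ).mapIso i).toLinearEquiv.length_eq

variable [FiniteDimensional k Λ]

lemma length_ne_top (M : FinMod k Λ) : Module.length Λ ((toModuleCat k Λ).obj M) ≠ ⊤ := by
  have : IsArtinianRing Λ := isArtinian_of_tower k inferInstance
  have : IsNoetherianRing Λ := isNoetherian_of_tower k inferInstance
  exact Module.length_ne_top

lemma length_biprod (M N : FinMod k Λ) : length k (M ⊞ N) = length k M + length k N := by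
  have := preservesBinaryBiproducts_of_preservesBiproducts (toModuleCat k Λ)
  have h := ((toModuleCat k Λ).mapBiprod M N ≪≫
    ModuleCat.biprodIsoProd _ _).toLinearEquiv.length_eq
  unfold length
  rw [h, ← ENat.toNat_add (length_ne_top M) (length_ne_top N)]
  exact congrArg ENat.toNat (Module.length_prod Λ _ _)

lemma isZero_of_length_eq_zero {M : FinMod k Λ} (h : length k M = 0) : IsZero M := by
  rw [isZero_iff_subsingleton, ← Module.length_eq_zero_iff (R := Λ)]
  exact (ENat.toNat_eq_zero.1 h).resolve_right (length_ne_top M)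

end FinMod

end Length

/-! ### Total cohomology length on `m`-mod `Λ` -/

section ExtModLength

variable (k : Type u) {Λ : Type v} [Field k] [Ring Λ] [Algebra k Λ] [FiniteDimensional k Λ]
  [HasDerivedCategory.{w₁} (FinMod k Λ)] (m : ℕ)

namespace ExtMod

variable (Λ) in
/-- The cohomology functor `Hⁱ` from `m`-mod `Λ` to `mod Λ`. -/
noncomputable def homology (i : ℤ) : ExtMod k Λ m ⥤ FinMod k Λ :=
  (isExtMod k Λ m).ι ⋙ DerivedCategory.Bounded.ι ⋙ DerivedCategory.homologyFunctor _ i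

instance (i : ℤ) : (homology k Λ m i).Additive := by
  unfold homology
  infer_instance

end ExtMod

namespace ExtMod

variable {k m}

/-- The sum of the lengths of the cohomology modules of an object of `m`-mod `Λ`. -/
noncomputable def length (X : ExtMod k Λ m) : ℕ :=
  ∑ i ∈ Finset.Icc (-((m : ℤ) - 1)) 0, FinMod.length k ((homology k Λ m i).obj X)

lemma length_eq_of_iso {X Y : ExtMod k Λ m} (i : X ≅ Y) : length X = length Y :=
  Finset.sum_congr rfl fun n _ => FinMod.length_eq_of_iso ((homology k Λ m n).mapIso i)

lemma length_biprod (X Y : ExtMod k Λ m) : length (X ⊞ Y) = length X + length Y := by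
  unfold length
  rw [← Finset.sum_add_distrib]
  refine Finset.sum_congr rfl fun n _ => ?_
  have := preservesBinaryBiproducts_of_preservesBiproducts (homology k Λ m n)
  exact (FinMod.length_eq_of_iso
    ((homology k Λ m n).mapBiprod X Y)).trans (FinMod.length_biprod _ _)

lemma isZero_of_isZero_obj (X : ExtMod k Λ m) (h : IsZero X.obj.obj) : IsZero X := by
  let F := (isExtMod k Λ m).ι ⋙ DerivedCategory.Bounded.ι
  have hF : IsZero (F.obj X) := h
  rw [IsZero.iff_id_eq_zero, ← F.map_id] at hF
  exact (IsZero.iff_id_eq_zero X).2 (F.map_eq_zero_iff.1 hF)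

lemma isZero_of_length_eq_zero (X : ExtMod k Λ m) (h : length X = 0) : IsZero X := by
  refine isZero_of_isZero_obj X (DerivedCategory.isZero_of_isZero_homology _ fun i => ?_)
  by_cases hi : i ∈ Set.Icc (-((m : ℤ) - 1)) 0
  · exact FinMod.isZero_of_length_eq_zero
      (Finset.sum_eq_zero_iff.1 h i (Finset.mem_Icc.2 hi))
  · exact X.property i hi

end ExtMod

end ExtModLength

/-! ### The induced functor from `m`-mod `Λ` to `m`-mod `eΛe` -/

section ExtModCorner

variable (k : Type u) {Λ : Type v} [Field k] [Ring Λ] [Algebra k Λ] [FiniteDimensional k Λ]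
  (m : ℕ) {e : Λ} (he : IsIdempotentElem e)
  [HasDerivedCategory.{w₁} (FinMod k Λ)] [HasDerivedCategory.{w₂} (FinMod k he.Corner)]

/-- The t-structure bounds are what allows `X` to be represented by a complex concentrated in these
degrees. -/
lemma isExtMod_iff (X : DerivedCategory.Bounded (FinMod k Λ)) :
    isExtMod k Λ m X ↔ X.obj.IsGE (-((m : ℤ) - 1)) ∧ X.obj.IsLE 0 := by
  rw [DerivedCategory.isGE_iff, DerivedCategory.isLE_iff]
  constructor
  · intro h
    exact ⟨fun i hi => h i fun h' => by have := h'.1; lia,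
      fun i hi => h i fun h' => by have := h'.2; lia⟩
  · rintro ⟨h₁, h₂⟩ i hi
    by_cases h : i < -((m : ℤ) - 1)
    · exact h₁ i h
    · exact h₂ i (not_le.1 fun h' => hi ⟨not_lt.1 h, h'⟩)

namespace ExtMod

/-- The functor from `m`-mod `Λ` to `m`-mod `eΛe` induced by the exact functor `M ↦ eM`. -/
noncomputable def part : ExtMod k Λ m ⥤ ExtMod k he.Corner m :=
  (isExtMod k he.Corner m).lift
    (DerivedCategory.TStructure.t.bounded.lift
      ((isExtMod k Λ m).ι ⋙ DerivedCategory.Bounded.ι ⋙ (FinMod.part k he).mapDerivedCategory)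
      fun X => DerivedCategory.bounded_mapDerivedCategory _ _ X.obj.property)
    fun X i hi => ((FinMod.part k he).map_isZero (X.property i hi)).of_iso
      (DerivedCategory.nonempty_homology_mapDerivedCategory_iso (FinMod.part k he) X.obj.obj i).some

instance : (part k m he).Additive where
  map_add {X Y f g} := by
    let F := (isExtMod k he.Corner m).ι ⋙ DerivedCategory.Bounded.ι
    refine F.map_injective ?_
    rw [F.map_add]
    exact Functor.map_add ((isExtMod k Λ m).ι ⋙ DerivedCategory.Bounded.ι ⋙
      (FinMod.part k he).mapDerivedCategory)

instance : (part k m he).EssSurj where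
  mem_essImage X := by
    obtain ⟨_, _⟩ := (isExtMod_iff k m X.obj).1 X.property
    obtain ⟨Y, h₁, h₂, ⟨i⟩⟩ := DerivedCategory.exists_mapDerivedCategory_iso (FinMod.part k he)
      (FinMod.coind k he) (FinMod.coindPartIso k he) X.obj.obj (-((m : ℤ) - 1)) 0
    refine ⟨⟨⟨Y, ⟨_, h₁⟩, ⟨_, h₂⟩⟩, (isExtMod_iff k m _).2 ⟨h₁, h₂⟩⟩, ⟨?_⟩⟩
    exact ((isExtMod k he.Corner m).ι ⋙ DerivedCategory.Bounded.ι).preimageIso i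

end ExtMod

end ExtModCorner

theorem mainTheorem9 (k : Type u) [Field k] (Λ : Type v) [Ring Λ] [Algebra k Λ]
    [FiniteDimensional k Λ] (m : ℕ) (hm : 1 ≤ m) (e : Λ) (he : IsIdempotentElem e)
    [HasDerivedCategory.{w₁} (FinMod k Λ)] [HasDerivedCategory.{w₂} (FinMod k he.Corner)]
    (hfin : IsOfFiniteType (ExtMod k Λ m)) :
    IsOfFiniteType (ExtMod k he.Corner m) :=
  hfin.of_essSurj (ExtMod.part k m he) ExtMod.length ExtMod.length_eq_of_iso
    ExtMod.length_biprod ExtMod.isZero_of_length_eq_zero
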